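/- Let $\Omega$ be a compact topological space with a Borel probability measure $\mu$, and let $C(\Omega)$ be the space of continuous (real- or complex-valued) functions on $\Omega$ with the uniform norm $\|\cdot\|_\infty$. For $W\subset C(\Omega)$ and an integer $k\ge 0$ put $$\varepsilon_k(W,L_\infty):=\inf\Bigl\{\varepsilon>0:\ \exists\, y^1,\dots,y^{2^k}\in W,\ \forall f\in W\ \exists j:\ \|f-y^j\|_\infty\le\varepsilon\Bigr\},$$ and for an integer $m\ge1$ and $p\ge 1$ put $$er_m(W,L_p):=\inf_{\xi^1,\dots,\xi^m\in\Omega}\ \sup_{f\in W}\Bigl|\int_\Omega|f|^p\,d\mu-\frac1m\sum_{j=1}^m|f(\xi^j)|^p\Bigr|.$$ Let $\log$ denote the logarithm to base $2$. Let $M>0$, $B>0$, $p\in[2,\infty)$, $b\ge0$, $r\in(0,1)$, and let $n_0\ge1$ be an integer. There is a constant $C=C(M,B,p,r,b,n_0)>0$, depending only on the listed parameters (in particular not on $\Omega$, $\mu$ or $W$), such that for every $\Omega$ and $\mu$ as above and every $W\subset C(\Omega)$ with $0\in W$, $\|f\|_\infty\le M$ for all $f\in W$, and $$\varepsilon_n(W,L_\infty)\le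 Bn^{-r}[\log(n+1)]^b\qquad\text{for all integers } n\ge n_0,$$ the following holds: 1. if $r\in(0,1/2)$, then $er_m(W,L_p)\le Cm^{-r}[\log(m+1)]^b$ for all integers $m\ge n_0$; 2. if $r=1/2$, then $er_m(W,L_p)\le Cm^{-1/2}[\log(m+1)]^{b+1}$ for all integers $m\ge n_0$; 3. if $r\in(1/2,1)$, then $er_m(W,L_p)\le Cm^{-1/2}$ for all integers $m\ge n_0$. -/

import Mathlib

open MeasureTheory
open scoped ENNReal

/-- The `k`-th entropy number of a set `W` in a seminormed space `X`: the infimum of the radii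
`ε > 0` such that `W` is covered by `2 ^ k` closed balls of radius `ε` centred at points of `W`
(repetitions of centres are allowed).  It is `⊤` when there is no such covering. -/
noncomputable def entropyNumber {X : Type*} [SeminormedAddCommGroup X] (k : ℕ) (W : Set X) :
    ℝ≥0∞ :=
  ⨅ (ε : ℝ) (_ : 0 < ε ∧ ∃ y : Fin (2 ^ k) → X,
      (∀ j, y j ∈ W) ∧ W ⊆ ⋃ j, Metric.closedBall (y j) ε), ENNReal.ofReal ε

/-- The `m`-th discretization number `er_m(W, L_p)` (for `1 ≤ m`) of a class `W` of continuous
functions on a compact space `Ω` with measure `μ`: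
the infimum over `m`-tuples of points of `Ω` of the supremum over `f ∈ W` of
`| ∫ |f|^p dμ - (1/m) ∑ |f(ξ_j)|^p |`. -/
noncomputable def discretizationNumber {Ω 𝕜 : Type*} [TopologicalSpace Ω] [MeasurableSpace Ω]
    [RCLike 𝕜] (μ : Measure Ω) (p : ℝ) (m : ℕ) (W : Set C(Ω, 𝕜)) : ℝ≥0∞ :=
  ⨅ ξ : Fin m → Ω, ⨆ f ∈ W,
    ENNReal.ofReal |(∫ x, ‖f x‖ ^ p ∂μ) - (1 / (m : ℝ)) * ∑ j, ‖f (ξ j)‖ ^ p|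

/-! Random independent points work with positive probability. By Hoeffding and a union bound, `2 ^
n` functions bounded by `a` have simultaneous deviations of order `a * √(n / m)`. Chaining through
finer and finer nets applies this to differences of neighbouring net points, which are as small as
the coarser net radius (`exists_sample_of_nets`). The map `z ↦ z ^ p` is Lipschitz on `[0, M]`, so
uniform nets of `W` serve for the functions `|f|^p`.

With nets of cardinality `2 ^ N k`, `N k = n₀ * 2 ^ k`, stopped when `N K` is comparable to `m`, the
error is at most a constant times `m^(-1/2) * (1 + ∑ N_k^(1/2 - r) * log^b)`
(`discretizationNumber_le_dyadic_sum`). The three rates are the three behaviours of this sum: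
dominated by its last term for `r < 1/2`, about `log m` comparable terms for `r = 1/2`, convergent
for `r > 1/2`. -/

/-! ### Concentration and chaining -/

/-- **Hoeffding's inequality** for the empirical mean of a bounded function at independent sample
points. -/
theorem measureReal_lt_abs_integral_sub_mean_le {Ω : Type*} [MeasurableSpace Ω] (μ : Measure Ω)
    [IsProbabilityMeasure μ] {m : ℕ} (hm : 1 ≤ m) {g : Ω → ℝ} (hg : Measurable g) {a t : ℝ}
    (ha : ∀ x, |g x| ≤ a) (ht : 0 ≤ t) :
    (Measure.pi fun _ : Fin m => μ).real
        {ξ | t < |(∫ x, g x ∂μ) - (1 / (m : ℝ)) * ∑ j, g (ξ j)|} ≤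
      2 * Real.exp (-(m * t ^ 2 / (2 * a ^ 2))) := by
  set P := Measure.pi fun _ : Fin m => μ with hP
  have hm0 : (0 : ℝ) < m := by exact_mod_cast hm
  set X : Ω → ℝ := fun x => g x - ∫ y, g y ∂μ with hX
  have hXm : Measurable X := hg.sub_const _
  have hint : Integrable g μ :=
    Integrable.of_bound hg.aestronglyMeasurable a (Filter.Eventually.of_forall ha)
  have hX0 : ∫ x, X x ∂μ = 0 := by
    rw [hX, integral_sub hint (integrable_const _)]
    simp
  have hsub : ProbabilityTheory.HasSubgaussianMGF X
      ((‖(a - ∫ y, g y ∂μ) - (-a - ∫ y, g y ∂μ)‖₊ / 2) ^ 2) μ := by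
    refine ProbabilityTheory.hasSubgaussianMGF_of_mem_Icc_of_integral_eq_zero hXm.aemeasurable
      (Filter.Eventually.of_forall fun x => ?_) hX0
    have := abs_le.mp (ha x)
    constructor <;> simp only [hX] <;> linarith
  set c : NNReal := (‖(a - ∫ y, g y ∂μ) - (-a - ∫ y, g y ∂μ)‖₊ / 2) ^ 2 with hc
  have hca : (c : ℝ) = a ^ 2 := by
    rw [hc]
    push_cast
    rw [div_pow, Real.norm_eq_abs, sq_abs]
    ring
  have hmp : ∀ j : Fin m, MeasurePreserving (fun ξ : Fin m → Ω => ξ j) P μ :=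
    fun j => measurePreserving_eval _ j
  have hsubj : ∀ j : Fin m,
      ProbabilityTheory.HasSubgaussianMGF (fun ξ : Fin m → Ω => X (ξ j)) c P := by
    intro j
    have := hsub
    rw [← (hmp j).map_eq] at this
    exact this.of_map (hmp j).measurable.aemeasurable
  have hind : ProbabilityTheory.iIndepFun (fun (j : Fin m) (ξ : Fin m → Ω) => X (ξ j)) P :=
    ProbabilityTheory.iIndepFun_pi fun _ => hXm.aemeasurable
  have hS := ProbabilityTheory.HasSubgaussianMGF.sum_of_iIndepFun hind (s := Finset.univ)
    (c := fun _ => c) fun j _ => hsubj j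
  have hmt : 0 ≤ (m : ℝ) * t := by positivity
  have h1 := hS.measure_ge_le hmt
  have h2 := hS.neg.measure_ge_le hmt
  have hexp : -(m * t) ^ 2 / (2 * ((∑ _j : Fin m, c : NNReal) : ℝ)) =
      -(m * t ^ 2 / (2 * a ^ 2)) := by
    simp only [Finset.sum_const, Finset.card_univ, Fintype.card_fin, nsmul_eq_mul]
    push_cast
    rw [hca]
    -- For `a = 0` both quotients are `0` by the convention on division by zero.
    rcases eq_or_ne a 0 with h | h
    · simp [h]
    · field_simp
  rw [hexp] at h1 h2
  refine (measureReal_mono (fun ξ hξ => ?_)).trans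
    ((measureReal_union_le _ _).trans ((add_le_add h1 h2).trans_eq (two_mul _).symm))
  have hsum : ∑ j, X (ξ j) = ∑ j, g (ξ j) - m * ∫ y, g y ∂μ := by
    simp [hX, Finset.sum_sub_distrib]
  have hmean : m * ((∫ x, g x ∂μ) - (1 / (m : ℝ)) * ∑ j, g (ξ j)) = -∑ j, X (ξ j) := by
    rw [hsum]
    field_simp
    ring
  rcases lt_abs.mp (Set.mem_ofPred_eq ▸ hξ) with h | h
  · right
    have := mul_lt_mul_of_pos_left h hm0
    simp only [Set.mem_ofPred_eq, Pi.neg_apply]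
    linarith
  · left
    have := mul_lt_mul_of_pos_left h hm0
    simp only [Set.mem_ofPred_eq]
    linarith

/-- A finite family of bounded functions has a common sample of `m` points at which all deviations
of the means are controlled, provided the Hoeffding bounds add up to less than one. -/
theorem exists_sample {Ω ι : Type*} [MeasurableSpace Ω] (μ : Measure Ω) [IsProbabilityMeasure μ]
    [Fintype ι] {m : ℕ} (hm : 1 ≤ m) {g : ι → Ω → ℝ} (hg : ∀ i, Measurable (g i)) {a t : ι → ℝ}
    (ha : ∀ i x, |g i x| ≤ a i) (ht : ∀ i, 0 ≤ t i)
    (hsum : ∑ i, 2 * Real.exp (-(m * t i ^ 2 / (2 * a i ^ 2))) < 1) :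
    ∃ ξ : Fin m → Ω, ∀ i, |(∫ x, g i x ∂μ) - (1 / (m : ℝ)) * ∑ j, g i (ξ j)| ≤ t i := by
  by_contra! hcon
  have hcover : (Set.univ : Set (Fin m → Ω)) ⊆
      ⋃ i, {ξ | t i < |(∫ x, g i x ∂μ) - (1 / (m : ℝ)) * ∑ j, g i (ξ j)|} := fun ξ _ =>
    Set.mem_iUnion.mpr (hcon ξ)
  have h1 := (measureReal_mono (μ := Measure.pi fun _ : Fin m => μ) hcover).trans
    ((measureReal_iUnion_fintype_le _).trans (Finset.sum_le_sum fun i _ =>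
      measureReal_lt_abs_integral_sub_mean_le μ hm (hg i) (ha i) (ht i)))
  rw [probReal_univ] at h1
  exact absurd hsum h1.not_gt

/-- The threshold `3 * a * √(n / m)` makes the Hoeffding exponent `9 * n / 2`. As `exp (-9/2) ≤
1/32`, this beats the `2 ^ n` members of a net and still leaves geometric decay for summing over the
levels. -/
theorem two_pow_mul_exp_le {m n : ℕ} (hm : 1 ≤ m) {a : ℝ} (ha : 0 < a) :
    (2 : ℝ) ^ n * (2 * Real.exp (-(m * (3 * a * √(n / m)) ^ 2 / (2 * a ^ 2)))) ≤
      2 * (1 / 16) ^ n := by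
  have hm0 : (0 : ℝ) < m := by exact_mod_cast hm
  have h1 : (m : ℝ) * (3 * a * √(n / m)) ^ 2 / (2 * a ^ 2) = n * (9 / 2) := by
    rw [mul_pow, Real.sq_sqrt (by positivity)]
    field_simp
    ring
  have h2 : Real.exp (-(9 / 2)) ≤ 1 / 32 := by
    rw [Real.exp_neg, one_div]
    refine inv_anti₀ (by norm_num) ?_
    have h3 : (2.7 : ℝ) ^ 4 ≤ Real.exp 1 ^ 4 :=
      pow_le_pow_left₀ (by norm_num) (by linarith [Real.exp_one_gt_d9]) 4
    rw [← Real.exp_nat_mul] at h3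
    have h4 : Real.exp ((4 : ℕ) * 1) ≤ Real.exp (9 / 2) := Real.exp_le_exp.mpr (by norm_num)
    refine le_trans ?_ (h3.trans h4)
    norm_num
  rw [h1, ← mul_neg, Real.exp_nat_mul]
  calc (2 : ℝ) ^ n * (2 * Real.exp (-(9 / 2)) ^ n) ≤ 2 ^ n * (2 * (1 / 32) ^ n) := by gcongr
    _ = 2 * (1 / 16) ^ n := by
      rw [mul_left_comm, ← mul_pow]
      norm_num

/-- **Chaining**: a class of bounded functions with nets of cardinality `2 ^ N k` and radius `δ k`
in the uniform norm has a sample of `m` points with a Dudley-type error bound. -/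
theorem exists_sample_of_nets {Ω : Type*} [MeasurableSpace Ω] (μ : Measure Ω)
    [IsProbabilityMeasure μ] {m : ℕ} (hm : 1 ≤ m) {S : Set (Ω → ℝ)} (hS : ∀ h ∈ S, Measurable h)
    {A : ℝ} (hA : 0 < A) (hSA : ∀ h ∈ S, ∀ x, |h x| ≤ A) {N : ℕ → ℕ} (hN : ∀ k, k + 1 ≤ N k)
    {δ : ℕ → ℝ} (hδ : ∀ k, 0 < δ k) {y : ∀ k, Fin (2 ^ N k) → Ω → ℝ} (hy : ∀ k j, y k j ∈ S)
    (hcov : ∀ k, ∀ h ∈ S, ∃ j, ∀ x, |h x - y k j x| ≤ δ k) (K : ℕ) :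
    ∃ ξ : Fin m → Ω, ∀ h ∈ S, |(∫ x, h x ∂μ) - (1 / (m : ℝ)) * ∑ j, h (ξ j)| ≤
      2 * δ K + 3 * A * √(N 0 / m) + ∑ k ∈ Finset.range K, 3 * δ k * √(N (k + 1) / m) := by
  have hm0 : (0 : ℝ) < m := by exact_mod_cast hm
  choose! π hπ using hcov
  -- The links of the chain. The predecessor of a net point is a function of that point, so level `k
  -- + 1` has only `2 ^ N (k + 1)` links, each bounded by `δ k`; level `0` uses the net itself,
  -- bounded by `A`.
  let G : ∀ k, Fin (2 ^ N k) → Ω → ℝ := fun k => match k with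
    | 0 => fun j => y 0 j
    | k + 1 => fun j x => y (k + 1) j x - y k (π k (y (k + 1) j)) x
  let a : ℕ → ℝ := fun k => match k with
    | 0 => A
    | k + 1 => δ k
  have hint : ∀ h ∈ S, Integrable h μ := fun h hh =>
    Integrable.of_bound (hS h hh).aestronglyMeasurable A (Filter.Eventually.of_forall (hSA h hh))
  have ha0 : ∀ k, 0 < a k := by
    rintro (_ | k)
    exacts [hA, hδ k]
  have hGm : ∀ k j, Measurable (G k j) := by
    rintro (_ | k) j
    exacts [hS _ (hy 0 j), (hS _ (hy _ _)).sub (hS _ (hy _ _))]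
  have hGa : ∀ k j x, |G k j x| ≤ a k := by
    rintro (_ | k) j x
    exacts [hSA _ (hy 0 j) x, hπ k _ (hy (k + 1) j) x]
  obtain ⟨ξ, hξ⟩ := exists_sample μ (ι := Σ k : Fin (K + 1), Fin (2 ^ N k)) hm
    (g := fun i => G i.1 i.2) (fun i => hGm _ _) (a := fun i => a i.1)
    (t := fun i => 3 * a i.1 * √(N i.1 / m)) (fun i x => hGa _ _ x)
    (fun i => by have := ha0 i.1; positivity) (by
      rw [Fintype.sum_sigma]
      simp only [Finset.sum_const, Finset.card_univ, Fintype.card_fin, nsmul_eq_mul]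
      push_cast
      -- Since `N k ≥ k + 1`, the failure probabilities over all levels add up to less than `2/15`.
      have hle : ∀ k : ℕ, (2 : ℝ) ^ N k *
          (2 * Real.exp (-(m * (3 * a k * √(N k / m)) ^ 2 / (2 * a k ^ 2)))) ≤
          2 * (1 / 16) ^ (k + 1) := fun k =>
        (two_pow_mul_exp_le hm (ha0 k)).trans (mul_le_mul_of_nonneg_left
          (pow_le_pow_of_le_one (by norm_num) (by norm_num) (hN k)) zero_le_two)
      refine (Finset.sum_le_sum fun (k : Fin (K + 1)) _ => hle k).trans_lt ?_
      rw [Fin.sum_univ_eq_sum_range fun k => (2 : ℝ) * (1 / 16) ^ (k + 1)]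
      have hgeom : ∀ n : ℕ, ∑ k ∈ Finset.range n, (2 : ℝ) * (1 / 16) ^ (k + 1) =
          2 / 15 * (1 - (1 / 16) ^ n) := by
        intro n
        induction n with
        | zero => simp
        | succ n ih => rw [Finset.sum_range_succ, ih]; ring
      rw [hgeom]
      have : (0 : ℝ) ≤ (1 / 16) ^ (K + 1) := by positivity
      linarith)
  refine ⟨ξ, ?_⟩
  let D : (Ω → ℝ) → ℝ := fun h => (∫ x, h x ∂μ) - (1 / (m : ℝ)) * ∑ j, h (ξ j)
  have hDsub : ∀ h₁ ∈ S, ∀ h₂ ∈ S, D (fun x => h₁ x - h₂ x) = D h₁ - D h₂ := by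
    intro h₁ hh₁ h₂ hh₂
    simp only [D]
    rw [integral_sub (hint _ hh₁) (hint _ hh₂), Finset.sum_sub_distrib]
    ring
  have hnet : ∀ k ≤ K, ∀ j, |D (y k j)| ≤
      3 * A * √(N 0 / m) + ∑ i ∈ Finset.range k, 3 * δ i * √(N (i + 1) / m) := by
    intro k
    induction k with
    | zero =>
      intro _ j
      rw [Finset.range_zero, Finset.sum_empty, add_zero]
      exact hξ ⟨⟨0, Nat.succ_pos K⟩, j⟩
    | succ k ih =>
      intro hk j
      have h1 := ih (by omega) (π k (y (k + 1) j))
      have h2 : |D (fun x => y (k + 1) j x - y k (π k (y (k + 1) j)) x)| ≤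
          3 * δ k * √(N (k + 1) / m) := hξ ⟨⟨k + 1, by omega⟩, j⟩
      rw [hDsub _ (hy _ _) _ (hy _ _)] at h2
      rw [Finset.sum_range_succ]
      have h3 := abs_sub_abs_le_abs_sub (D (y (k + 1) j)) (D (y k (π k (y (k + 1) j))))
      linarith
  -- Passing from `h` to its nearest point in the finest net costs `δ K` in the integral and `δ K`
  -- in the mean.
  intro h hh
  have h1 := hnet K le_rfl (π K h)
  have h2 := hπ K h hh
  have h3 : |∫ x, (h x - y K (π K h) x) ∂μ| ≤ δ K := by
    have := norm_integral_le_of_norm_le_const (μ := μ)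
      (Filter.Eventually.of_forall fun x => (Real.norm_eq_abs _).trans_le (h2 x))
    simpa using this
  have h4 : |(1 / (m : ℝ)) * ∑ j, (h (ξ j) - y K (π K h) (ξ j))| ≤ δ K := by
    rw [abs_mul, abs_of_pos (by positivity : 0 < 1 / (m : ℝ)), one_div, inv_mul_le_iff₀ hm0]
    refine (Finset.abs_sum_le_sum_abs _ _).trans ((Finset.sum_le_sum fun j _ => h2 (ξ j)).trans ?_)
    simp
  have h5 := hDsub h hh _ (hy K (π K h))
  have h6 : |D h - D (y K (π K h))| ≤ 2 * δ K := by
    rw [← h5]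
    exact (abs_sub _ _).trans (by linarith)
  have h7 := abs_sub_abs_le_abs_sub (D h) (D (y K (π K h)))
  change |D h| ≤ _
  linarith

/-! ### Elementary inequalities and dyadic sums -/

theorem Real.abs_rpow_sub_rpow_le {p M x y : ℝ} (hp : 1 ≤ p) (hx : 0 ≤ x) (hxM : x ≤ M)
    (hy : 0 ≤ y) (hyM : y ≤ M) : |x ^ p - y ^ p| ≤ p * M ^ (p - 1) * |x - y| := by
  refine Convex.norm_image_sub_le_of_norm_hasDerivWithin_le (s := Set.Icc 0 M)
    (f := fun z : ℝ => z ^ p) (f' := fun z => p * z ^ (p - 1))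
    (fun z _ => (Real.hasDerivAt_rpow_const (Or.inr hp)).hasDerivWithinAt) (fun z hz => ?_)
    (convex_Icc 0 M) ⟨hy, hyM⟩ ⟨hx, hxM⟩
  have hz1 : 0 ≤ z ^ (p - 1) := Real.rpow_nonneg hz.1 _
  rw [Real.norm_eq_abs, abs_of_nonneg (by positivity)]
  exact mul_le_mul_of_nonneg_left (Real.rpow_le_rpow hz.1 hz.2 (by linarith)) (by linarith)

theorem one_le_logb_two_add_one {x : ℝ} (hx : 1 ≤ x) : 1 ≤ Real.logb 2 (x + 1) := by
  rw [Real.le_logb_iff_rpow_le one_lt_two (by linarith)]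
  simpa using by linarith

theorem logb_two_add_one_mono {x y : ℝ} (hx : 0 ≤ x) (h : x ≤ y) :
    Real.logb 2 (x + 1) ≤ Real.logb 2 (y + 1) :=
  Real.logb_le_logb_of_le one_lt_two (by linarith) (by linarith)

theorem exists_dyadic {n m : ℕ} (hn : 1 ≤ n) (hnm : n ≤ m) :
    ∃ K : ℕ, n * 2 ^ K ≤ m ∧ m < 2 * (n * 2 ^ K) := by
  refine ⟨Nat.log 2 (m / n), ?_, ?_⟩
  · exact (Nat.mul_le_mul_left n (Nat.pow_log_le_self 2 (Nat.div_pos hnm hn).ne')).trans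
      (Nat.mul_div_le m n)
  · have := (Nat.div_lt_iff_lt_mul hn).mp (Nat.lt_pow_succ_log_self one_lt_two (m / n))
    rw [pow_succ] at this
    linarith

/-- The dyadic entropy sum, for `s > 0`, is dominated by its last term. -/
theorem sum_dyadic_le_of_pos {n : ℕ} (hn : 1 ≤ n) {s b : ℝ} (hs : 0 < s) (hb : 0 ≤ b) {m K : ℕ}
    (hK : n * 2 ^ K ≤ m) :
    ∑ k ∈ Finset.range (K + 1), ((n * 2 ^ k : ℕ) : ℝ) ^ s *
        Real.logb 2 (((n * 2 ^ k : ℕ) : ℝ) + 1) ^ b ≤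
      2 ^ s / (2 ^ s - 1) * ((m : ℝ) ^ s * Real.logb 2 ((m : ℝ) + 1) ^ b) := by
  have hq : (1 : ℝ) < 2 ^ s := Real.one_lt_rpow one_lt_two hs
  have hq1 : (0 : ℝ) < 2 ^ s - 1 := by linarith
  -- With the logarithm frozen at its largest value, a geometric sum of ratio `2 ^ s > 1` remains.
  have hterm : ∀ k ∈ Finset.range (K + 1), ((n * 2 ^ k : ℕ) : ℝ) ^ s *
        Real.logb 2 (((n * 2 ^ k : ℕ) : ℝ) + 1) ^ b ≤
      (n : ℝ) ^ s * Real.logb 2 ((m : ℝ) + 1) ^ b * (2 ^ s) ^ k := by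
    intro k hk
    have hkm : n * 2 ^ k ≤ m :=
      (Nat.mul_le_mul_left n (Nat.pow_le_pow_right two_pos
        (Nat.lt_succ_iff.mp (Finset.mem_range.mp hk)))).trans hK
    have h1 : Real.logb 2 (((n * 2 ^ k : ℕ) : ℝ) + 1) ^ b ≤ Real.logb 2 ((m : ℝ) + 1) ^ b :=
      Real.rpow_le_rpow (Real.logb_nonneg one_lt_two (by simp))
        (logb_two_add_one_mono (by positivity) (by exact_mod_cast hkm)) hb
    have h2 : ((n * 2 ^ k : ℕ) : ℝ) ^ s = (n : ℝ) ^ s * (2 ^ s) ^ k := by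
      push_cast
      rw [Real.mul_rpow (by positivity) (by positivity), Real.rpow_pow_comm (by norm_num)]
    rw [h2, mul_right_comm]
    gcongr
  refine (Finset.sum_le_sum hterm).trans ?_
  rw [← Finset.mul_sum, geom_sum_eq hq.ne']
  have hKm : (n : ℝ) ^ s * (2 ^ s) ^ K ≤ (m : ℝ) ^ s := by
    rw [Real.rpow_pow_comm (by norm_num), ← Real.mul_rpow (by positivity) (by positivity)]
    exact Real.rpow_le_rpow (by positivity) (by exact_mod_cast hK) hs.le
  have hl : 0 ≤ Real.logb 2 ((m : ℝ) + 1) ^ b :=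
    Real.rpow_nonneg (Real.logb_nonneg one_lt_two (by simp)) _
  calc (n : ℝ) ^ s * Real.logb 2 ((m : ℝ) + 1) ^ b * (((2 ^ s) ^ (K + 1) - 1) / (2 ^ s - 1))
      ≤ (n : ℝ) ^ s * Real.logb 2 ((m : ℝ) + 1) ^ b * ((2 ^ s) ^ (K + 1) / (2 ^ s - 1)) := by
        gcongr
        linarith
    _ = 2 ^ s / (2 ^ s - 1) * ((n : ℝ) ^ s * (2 ^ s) ^ K * Real.logb 2 ((m : ℝ) + 1) ^ b) := by
        rw [pow_succ]
        ring
    _ ≤ _ := by gcongr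

/-- The dyadic sum of powers of the logarithm. -/
theorem sum_dyadic_logb_le {n : ℕ} (hn : 1 ≤ n) {b : ℝ} (hb : 0 ≤ b) {m K : ℕ}
    (hK : n * 2 ^ K ≤ m) :
    ∑ k ∈ Finset.range (K + 1), Real.logb 2 (((n * 2 ^ k : ℕ) : ℝ) + 1) ^ b ≤
      2 * Real.logb 2 ((m : ℝ) + 1) ^ (b + 1) := by
  have hm : 1 ≤ m := (Nat.mul_pos hn (by positivity)).trans_le hK
  have hl1 : 1 ≤ Real.logb 2 ((m : ℝ) + 1) := one_le_logb_two_add_one (by exact_mod_cast hm)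
  have hterm : ∀ k ∈ Finset.range (K + 1),
      Real.logb 2 (((n * 2 ^ k : ℕ) : ℝ) + 1) ^ b ≤ Real.logb 2 ((m : ℝ) + 1) ^ b := by
    intro k hk
    have hkm : n * 2 ^ k ≤ m :=
      (Nat.mul_le_mul_left n (Nat.pow_le_pow_right two_pos
        (Nat.lt_succ_iff.mp (Finset.mem_range.mp hk)))).trans hK
    exact Real.rpow_le_rpow (Real.logb_nonneg one_lt_two (by simp))
      (logb_two_add_one_mono (by positivity) (by exact_mod_cast hkm)) hb
  refine (Finset.sum_le_sum hterm).trans ?_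
  -- There are `K + 1` terms, at most twice the logarithm: this is the extra power of the logarithm.
  have hKl : (K : ℝ) ≤ Real.logb 2 ((m : ℝ) + 1) := by
    rw [Real.le_logb_iff_rpow_le one_lt_two (by positivity), Real.rpow_natCast]
    have : 2 ^ K ≤ m + 1 := by nlinarith [Nat.one_le_two_pow (n := K)]
    exact_mod_cast this
  rw [Finset.sum_const, Finset.card_range, nsmul_eq_mul, Real.rpow_add (by linarith),
    Real.rpow_one]
  push_cast
  have : 0 ≤ Real.logb 2 ((m : ℝ) + 1) ^ b := Real.rpow_nonneg (by linarith) _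
  nlinarith

/-- The logarithm of `n * 2 ^ k + 1` is at most `k + n`, so the terms are dominated by a polynomial
times a geometric sequence of ratio `2 ^ s < 1`, shifted by `n`. -/
theorem summable_dyadic_of_neg {n : ℕ} (hn : 1 ≤ n) {s b : ℝ} (hs : s < 0) (hb : 0 ≤ b) :
    Summable fun k : ℕ => ((n * 2 ^ k : ℕ) : ℝ) ^ s *
      Real.logb 2 (((n * 2 ^ k : ℕ) : ℝ) + 1) ^ b := by
  have hq : (2 : ℝ) ^ s < 1 := Real.rpow_lt_one_of_one_lt_of_neg one_lt_two hs
  have hq0 : (0 : ℝ) < 2 ^ s := by positivity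
  have h1 := summable_pow_mul_geometric_of_norm_lt_one ⌈b⌉₊ (r := (2 : ℝ) ^ s)
    (by rwa [Real.norm_eq_abs, abs_of_pos hq0])
  have h2 := ((summable_nat_add_iff n).mpr h1).mul_left (((2 : ℝ) ^ s) ^ n)⁻¹
  refine h2.of_nonneg_of_le (fun k => by
    have := Real.logb_nonneg one_lt_two (x := ((n * 2 ^ k : ℕ) : ℝ) + 1) (by simp)
    positivity) fun k => ?_
  have hn1 : (1 : ℝ) ≤ n := by exact_mod_cast hn
  have h3 : ((n * 2 ^ k : ℕ) : ℝ) ^ s ≤ (2 ^ s) ^ k := by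
    push_cast
    rw [Real.mul_rpow (by positivity) (by positivity), ← Real.rpow_pow_comm (by norm_num)]
    exact mul_le_of_le_one_left (by positivity) (Real.rpow_le_one_of_one_le_of_nonpos hn1 hs.le)
  have h4 : Real.logb 2 (((n * 2 ^ k : ℕ) : ℝ) + 1) ≤ (k + n : ℕ) := by
    rw [Real.logb_le_iff_le_rpow one_lt_two (by positivity), Real.rpow_natCast]
    have h5 : n + 1 ≤ 2 ^ n := Nat.lt_two_pow_self
    have h6 : n * 2 ^ k + 1 ≤ 2 ^ (k + n) := by
      rw [pow_add]
      nlinarith [Nat.one_le_two_pow (n := k)]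
    exact_mod_cast h6
  have h5 : Real.logb 2 (((n * 2 ^ k : ℕ) : ℝ) + 1) ^ b ≤ ((k + n : ℕ) : ℝ) ^ ⌈b⌉₊ := by
    rw [← Real.rpow_natCast]
    refine (Real.rpow_le_rpow (Real.logb_nonneg one_lt_two (by simp)) h4 hb).trans ?_
    exact Real.rpow_le_rpow_of_exponent_le (by exact_mod_cast (by omega : 1 ≤ k + n))
      (Nat.le_ceil b)
  calc _ ≤ ((2 : ℝ) ^ s) ^ k * ((k + n : ℕ) : ℝ) ^ ⌈b⌉₊ := by
        gcongr
        exact Real.rpow_nonneg (Real.logb_nonneg one_lt_two (by simp)) _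
    _ = _ := by
        rw [pow_add]
        field_simp

/-! ### From entropy numbers to discretization numbers -/

theorem exists_net_of_entropyNumber_lt {X : Type*} [SeminormedAddCommGroup X] {n : ℕ} {W : Set X}
    {ε : ℝ} (h : entropyNumber n W < ENNReal.ofReal ε) :
    ∃ y : Fin (2 ^ n) → X, (∀ j, y j ∈ W) ∧ ∀ f ∈ W, ∃ j, ‖f - y j‖ ≤ ε := by
  rw [entropyNumber] at h
  obtain ⟨ε', h⟩ := iInf_lt_iff.mp h
  obtain ⟨⟨hε', y, hy, hcov⟩, h⟩ := iInf_lt_iff.mp h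
  have hlt := (ENNReal.ofReal_lt_ofReal_iff_of_nonneg hε'.le).mp h
  refine ⟨y, hy, fun f hf => ?_⟩
  obtain ⟨j, hj⟩ := Set.mem_iUnion.mp (hcov hf)
  rw [Metric.mem_closedBall, dist_eq_norm] at hj
  exact ⟨j, hj.trans hlt.le⟩

theorem discretizationNumber_le {Ω 𝕜 : Type*} [TopologicalSpace Ω] [MeasurableSpace Ω]
    [RCLike 𝕜] {μ : Measure Ω} {p : ℝ} {m : ℕ} {W : Set C(Ω, 𝕜)} {R : ℝ} {ξ : Fin m → Ω}
    (h : ∀ f ∈ W, |(∫ x, ‖f x‖ ^ p ∂μ) - (1 / (m : ℝ)) * ∑ j, ‖f (ξ j)‖ ^ p| ≤ R) :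
    discretizationNumber μ p m W ≤ ENNReal.ofReal R :=
  (iInf_le _ ξ).trans (iSup₂_le fun f hf => ENNReal.ofReal_le_ofReal (h f hf))

/-- The chaining bound for `p`-th powers of a class with nets of cardinality `2 ^ N k`. -/
theorem discretizationNumber_le_of_nets {Ω 𝕜 : Type*} [TopologicalSpace Ω] [CompactSpace Ω]
    [MeasurableSpace Ω] [BorelSpace Ω] [RCLike 𝕜] (μ : Measure Ω) [IsProbabilityMeasure μ]
    {M p : ℝ} (hM : 0 < M) (hp : 1 ≤ p) {m : ℕ} (hm : 1 ≤ m) {W : Set C(Ω, 𝕜)}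
    (hWM : ∀ f ∈ W, ‖f‖ ≤ M) {N : ℕ → ℕ} (hN : ∀ k, k + 1 ≤ N k) {δ : ℕ → ℝ} (hδ : ∀ k, 0 < δ k)
    (hent : ∀ k, entropyNumber (N k) W < ENNReal.ofReal (δ k)) (K : ℕ) :
    discretizationNumber μ p m W ≤ ENNReal.ofReal (2 * (p * M ^ (p - 1) * δ K) +
      3 * M ^ p * √(N 0 / m) +
      ∑ k ∈ Finset.range K, 3 * (p * M ^ (p - 1) * δ k) * √(N (k + 1) / m)) := by
  choose y hyW hy using fun k => exists_net_of_entropyNumber_lt (hent k)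
  have hfM : ∀ f ∈ W, ∀ x, ‖f x‖ ≤ M := fun f hf x => (f.norm_coe_le_norm x).trans (hWM f hf)
  obtain ⟨ξ, hξ⟩ := exists_sample_of_nets μ hm
    (S := (fun (f : C(Ω, 𝕜)) x => ‖f x‖ ^ p) '' W) (A := M ^ p) (N := N)
    (δ := fun k => p * M ^ (p - 1) * δ k) (y := fun k j x => ‖y k j x‖ ^ p)
    (by
      rintro _ ⟨f, -, rfl⟩
      exact (f.continuous.norm.rpow_const fun _ => Or.inr (by linarith)).measurable)
    (by positivity)
    (by
      rintro _ ⟨f, hf, rfl⟩ x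
      dsimp only
      rw [abs_of_nonneg (by positivity)]
      exact Real.rpow_le_rpow (norm_nonneg _) (hfM f hf x) (by linarith))
    hN (fun k => by have := hδ k; positivity) (fun k j => ⟨y k j, hyW k j, rfl⟩)
    (by
      rintro k _ ⟨f, hf, rfl⟩
      obtain ⟨j, hj⟩ := hy k f hf
      refine ⟨j, fun x => (Real.abs_rpow_sub_rpow_le hp (norm_nonneg _) (hfM f hf x)
        (norm_nonneg _) (hfM _ (hyW k j) x)).trans ?_⟩
      refine mul_le_mul_of_nonneg_left ((abs_norm_sub_norm_le _ _).trans ?_) (by positivity)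
      exact ((f - y k j).norm_coe_le_norm x).trans hj) K
  exact discretizationNumber_le fun f hf => hξ _ ⟨f, hf, rfl⟩

/-- The discretization number is bounded by a dyadic entropy sum. -/
theorem discretizationNumber_le_dyadic_sum {Ω 𝕜 : Type*} [TopologicalSpace Ω] [CompactSpace Ω]
    [MeasurableSpace Ω] [BorelSpace Ω] [RCLike 𝕜] (μ : Measure Ω) [IsProbabilityMeasure μ]
    {M B p b r : ℝ} (hM : 0 < M) (hB : 0 < B) (hp : 1 ≤ p) {n₀ : ℕ} (hn₀ : 1 ≤ n₀)
    {W : Set C(Ω, 𝕜)} (hWM : ∀ f ∈ W, ‖f‖ ≤ M)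
    (hent : ∀ n : ℕ, n₀ ≤ n → entropyNumber n W ≤
      ENNReal.ofReal (B * (n : ℝ) ^ (-r) * (Real.logb 2 ((n : ℝ) + 1)) ^ b))
    {m K : ℕ} (hK : n₀ * 2 ^ K ≤ m) (hmK : m < 2 * (n₀ * 2 ^ K)) :
    discretizationNumber μ p m W ≤ ENNReal.ofReal
      ((12 * (p * M ^ (p - 1)) * B + 3 * M ^ p * √n₀) * ((m : ℝ) ^ (-(1 / 2) : ℝ) *
        (1 + ∑ k ∈ Finset.range (K + 1), ((n₀ * 2 ^ k : ℕ) : ℝ) ^ (1 / 2 - r) *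
          Real.logb 2 (((n₀ * 2 ^ k : ℕ) : ℝ) + 1) ^ b))) := by
  set N : ℕ → ℕ := fun k => n₀ * 2 ^ k with hNdef
  have hN1 : ∀ k, 1 ≤ N k := fun k => Nat.mul_pos hn₀ (by positivity)
  have hN0 : ∀ k, (0 : ℝ) < N k := fun k => by exact_mod_cast hN1 k
  have hm : 1 ≤ m := (hN1 K).trans hK
  have hm0 : (0 : ℝ) < m := by exact_mod_cast hm
  have hl : ∀ k, 0 < Real.logb 2 ((N k : ℝ) + 1) ^ b := fun k =>
    Real.rpow_pos_of_pos (zero_lt_one.trans_le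
      (one_le_logb_two_add_one (by exact_mod_cast hN1 k))) _
  -- The factor `2` gives the strict inequality needed to extract a net, as the infimum may not be
  -- attained.
  set δ : ℕ → ℝ := fun k => 2 * (B * (N k : ℝ) ^ (-r) * Real.logb 2 ((N k : ℝ) + 1) ^ b) with hδ
  have hφ : ∀ k, 0 < B * (N k : ℝ) ^ (-r) * Real.logb 2 ((N k : ℝ) + 1) ^ b := fun k =>
    mul_pos (mul_pos hB (Real.rpow_pos_of_pos (hN0 k) _)) (hl k)
  have hδ0 : ∀ k, 0 < δ k := fun k => mul_pos two_pos (hφ k)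
  set T : ℕ → ℝ := fun k => (N k : ℝ) ^ (1 / 2 - r) * Real.logb 2 ((N k : ℝ) + 1) ^ b with hT
  have hT0 : ∀ k, 0 < T k := fun k => mul_pos (Real.rpow_pos_of_pos (hN0 k) _) (hl k)
  have hδT : ∀ k, δ k * √(N k) = 2 * B * T k := by
    intro k
    simp only [hδ, hT]
    rw [Real.sqrt_eq_rpow, sub_eq_add_neg, Real.rpow_add (hN0 k)]
    ring
  have hrm : (m : ℝ) ^ (-(1 / 2) : ℝ) = (√m)⁻¹ := by
    rw [Real.rpow_neg hm0.le, Real.sqrt_eq_rpow]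
  have hsm : 0 < √(m : ℝ) := Real.sqrt_pos.mpr hm0
  have hs2 : √(2 : ℝ) ≤ 2 := by
    rw [Real.sqrt_le_left two_pos.le]
    norm_num
  refine (discretizationNumber_le_of_nets μ hM hp hm hWM (N := N) (δ := δ) (fun k => ?_) hδ0
    (fun k => ?_) K).trans (ENNReal.ofReal_le_ofReal ?_)
  · have h1 : k + 1 ≤ 2 ^ k := Nat.lt_two_pow_self
    exact h1.trans (Nat.le_mul_of_pos_left _ hn₀)
  · refine (hent (N k) (Nat.le_mul_of_pos_right _ (by positivity))).trans_lt ?_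
    exact (ENNReal.ofReal_lt_ofReal_iff (hδ0 k)).mpr (by have := hφ k; simp only [hδ]; linarith)
  set D : ℝ := p * M ^ (p - 1) with hD
  have hD0 : 0 < D := by positivity
  -- Because `m < 2 * N K`, the residual error of the finest net is no larger than a constant times
  -- the last term of the sum.
  have hlast : 2 * (D * δ K) ≤ 12 * D * B * ((√m)⁻¹ * T K) := by
    have h1 : √(m : ℝ) ≤ 2 * √(N K) := by
      have h2 : √(m : ℝ) ≤ √(2 * N K) := Real.sqrt_le_sqrt (by exact_mod_cast hmK.le)
      rw [Real.sqrt_mul two_pos.le] at h2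
      exact h2.trans (by gcongr)
    have h2 : δ K * √m ≤ 4 * B * T K := by
      have := mul_le_mul_of_nonneg_left h1 (hδ0 K).le
      have h3 := hδT K
      linarith
    have h3 : δ K ≤ 4 * B * T K * (√m)⁻¹ := by
      rwa [← div_eq_mul_inv, le_div_iff₀ hsm]
    have h4 := mul_le_mul_of_nonneg_left h3 hD0.le
    have h5 : 0 ≤ D * B * ((√m)⁻¹ * T K) := by have := hT0 K; positivity
    linarith
  have hmid : ∀ k, 3 * (D * δ k) * √(N (k + 1) / m) ≤ 12 * D * B * ((√m)⁻¹ * T k) := by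
    intro k
    have h1 : √(N (k + 1) / m : ℝ) ≤ 2 * √(N k) * (√m)⁻¹ := by
      have h2 : (N (k + 1) : ℝ) = 2 * N k := by
        simp only [hNdef]
        push_cast
        ring
      rw [h2, Real.sqrt_div' _ hm0.le, Real.sqrt_mul two_pos.le, div_eq_mul_inv]
      gcongr
    have h3 := mul_le_mul_of_nonneg_left h1 (by have := hδ0 k; positivity : 0 ≤ 3 * (D * δ k))
    refine h3.trans_eq ?_
    linear_combination 6 * D * (√m)⁻¹ * hδT k
  have hfirst : 3 * M ^ p * √(N 0 / m) = 3 * M ^ p * √n₀ * (√m)⁻¹ := by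
    simp only [hNdef, pow_zero, mul_one]
    rw [Real.sqrt_div' _ hm0.le]
    ring
  have hsum := Finset.sum_le_sum fun k (_ : k ∈ Finset.range K) => hmid k
  rw [← Finset.mul_sum, ← Finset.mul_sum] at hsum
  rw [hrm, hfirst, Finset.sum_range_succ]
  have hsum0 : 0 ≤ ∑ k ∈ Finset.range K, T k := Finset.sum_nonneg fun k _ => (hT0 k).le
  have hTK := hT0 K
  change _ ≤ (12 * D * B + 3 * M ^ p * √n₀) *
    ((√m)⁻¹ * (1 + (∑ k ∈ Finset.range K, T k + T K)))
  have h1 : 0 ≤ 12 * D * B * (√m)⁻¹ := by positivity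
  have h2 : 0 ≤ 3 * M ^ p * √n₀ * (√m)⁻¹ * (∑ k ∈ Finset.range K, T k + T K) := by positivity
  linarith

/-! ### The three regimes of `r` -/

theorem corollary2p3 (M B p b r : ℝ) (n₀ : ℕ) (hM : 0 < M) (hB : 0 < B) (hp : 2 ≤ p)
    (hb : 0 ≤ b) (hr₀ : 0 < r) (hr₁ : r < 1) (hn₀ : 1 ≤ n₀) :
    ∃ C : ℝ, 0 < C ∧
      ∀ (𝕜 : Type) [RCLike 𝕜]
        (Ω : Type*) [TopologicalSpace Ω] [CompactSpace Ω] [MeasurableSpace Ω] [BorelSpace Ω]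
        (μ : Measure Ω) [IsProbabilityMeasure μ] (W : Set C(Ω, 𝕜)),
        (∀ f ∈ W, ‖f‖ ≤ M) →
        (0 : C(Ω, 𝕜)) ∈ W →
        (∀ n : ℕ, n₀ ≤ n →
          entropyNumber n W ≤
            ENNReal.ofReal (B * (n : ℝ) ^ (-r) * (Real.logb 2 ((n : ℝ) + 1)) ^ b)) →
        (r < 1 / 2 → ∀ m : ℕ, n₀ ≤ m →
          discretizationNumber μ p m W ≤
            ENNReal.ofReal (C * (m : ℝ) ^ (-r) * (Real.logb 2 ((m : ℝ) + 1)) ^ b)) ∧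
        (r = 1 / 2 → ∀ m : ℕ, n₀ ≤ m →
          discretizationNumber μ p m W ≤
            ENNReal.ofReal
              (C * (m : ℝ) ^ (-(1 / 2) : ℝ) * (Real.logb 2 ((m : ℝ) + 1)) ^ (b + 1))) ∧
        (1 / 2 < r → ∀ m : ℕ, n₀ ≤ m →
          discretizationNumber μ p m W ≤
            ENNReal.ofReal (C * (m : ℝ) ^ (-(1 / 2) : ℝ))) := by

  set E : ℝ := 12 * (p * M ^ (p - 1)) * B + 3 * M ^ p * √n₀ with hE
  have hp1 : 1 ≤ p := by linarith
  have hE0 : 0 < E := by positivity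
  set T : ℕ → ℝ := fun k => ((n₀ * 2 ^ k : ℕ) : ℝ) ^ (1 / 2 - r) *
    Real.logb 2 (((n₀ * 2 ^ k : ℕ) : ℝ) + 1) ^ b with hT
  have hT0 : ∀ k, 0 ≤ T k := fun k =>
    mul_nonneg (by positivity)
      (Real.rpow_nonneg (Real.logb_nonneg one_lt_two (by simp)) _)
  set c : ℝ := |2 ^ (1 / 2 - r) / (2 ^ (1 / 2 - r) - 1)| with hc
  have hs0 : 0 ≤ ∑' k, T k := tsum_nonneg hT0
  -- One constant for all regimes: `3` covers the `1 +` and the factor `2` at `r = 1/2`, `c` serves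
  -- `r < 1/2`, and the series serves `r > 1/2`. Outside their regimes `c` and the `tsum` may be
  -- meaningless, but they stay nonnegative, through the absolute value and nonnegative terms.
  refine ⟨E * (3 + c + ∑' k, T k), by positivity, ?_⟩
  intro 𝕜 _ Ω _ _ _ _ μ _ W hWM _ hent
  have key : ∀ m : ℕ, n₀ ≤ m → ∃ K : ℕ, n₀ * 2 ^ K ≤ m ∧
      discretizationNumber μ p m W ≤ ENNReal.ofReal
        (E * ((m : ℝ) ^ (-(1 / 2) : ℝ) * (1 + ∑ k ∈ Finset.range (K + 1), T k))) := by
    intro m hm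
    obtain ⟨K, hK, hmK⟩ := exists_dyadic hn₀ hm
    exact ⟨K, hK, discretizationNumber_le_dyadic_sum μ hM hB hp1 hn₀ hWM hent hK hmK⟩
  have hc0 : 0 ≤ c := abs_nonneg _
  refine ⟨fun hr m hm => ?_, fun hr m hm => ?_, fun hr m hm => ?_⟩ <;>
    obtain ⟨K, hK, hle⟩ := key m hm <;>
    refine hle.trans (ENNReal.ofReal_le_ofReal ?_) <;>
    have hm1 : (1 : ℝ) ≤ m := by exact_mod_cast hn₀.trans hm
  · have hs : 0 < 1 / 2 - r := by linarith
    have hl1 : 1 ≤ Real.logb 2 ((m : ℝ) + 1) := one_le_logb_two_add_one hm1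
    set Q : ℝ := (m : ℝ) ^ (1 / 2 - r) * Real.logb 2 ((m : ℝ) + 1) ^ b with hQ
    have h1 : ∑ k ∈ Finset.range (K + 1), T k ≤ c * Q :=
      (sum_dyadic_le_of_pos hn₀ hs hb hK).trans
        (mul_le_mul_of_nonneg_right (le_abs_self _) (by positivity))
    have h2 : 1 ≤ Q :=
      one_le_mul_of_one_le_of_one_le (Real.one_le_rpow hm1 hs.le) (Real.one_le_rpow hl1 hb)
    have h3 : 1 + ∑ k ∈ Finset.range (K + 1), T k ≤ (3 + c + ∑' k, T k) * Q := by
      have : 0 ≤ (∑' k, T k) * Q := by positivity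
      linarith
    have h4 : (m : ℝ) ^ (-r) = (m : ℝ) ^ (-(1 / 2) : ℝ) * (m : ℝ) ^ (1 / 2 - r) := by
      rw [← Real.rpow_add (by linarith)]
      congr 1
      ring
    calc _ ≤ E * ((m : ℝ) ^ (-(1 / 2) : ℝ) * ((3 + c + ∑' k, T k) * Q)) := by gcongr
      _ = _ := by
        rw [h4, hQ]
        ring
  · have hl1 : 1 ≤ Real.logb 2 ((m : ℝ) + 1) := one_le_logb_two_add_one hm1
    set Q : ℝ := Real.logb 2 ((m : ℝ) + 1) ^ (b + 1) with hQ
    have h1 : ∑ k ∈ Finset.range (K + 1), T k ≤ 2 * Q := by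
      simpa [hT, hr] using sum_dyadic_logb_le hn₀ hb hK
    have h2 : 1 ≤ Q := Real.one_le_rpow hl1 (by linarith)
    have h3 : 1 + ∑ k ∈ Finset.range (K + 1), T k ≤ (3 + c + ∑' k, T k) * Q := by
      have h4 : 0 ≤ (∑' k, T k) * Q := by positivity
      have h5 : 0 ≤ c * Q := by positivity
      linarith
    calc _ ≤ E * ((m : ℝ) ^ (-(1 / 2) : ℝ) * ((3 + c + ∑' k, T k) * Q)) := by gcongr
      _ = _ := by ring
  · have h1 : ∑ k ∈ Finset.range (K + 1), T k ≤ ∑' k, T k :=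
      (summable_dyadic_of_neg hn₀ (by linarith) hb).sum_le_tsum _ fun k _ => hT0 k
    have h3 : 1 + ∑ k ∈ Finset.range (K + 1), T k ≤ 3 + c + ∑' k, T k := by linarith
    calc _ ≤ E * ((m : ℝ) ^ (-(1 / 2) : ℝ) * (3 + c + ∑' k, T k)) := by gcongr
      _ = _ := by ring
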